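/- A \emph{map} is a finite simple connected graph $G=(V,E)$ with a cellular embedding in a closed orientable surface; equivalently, it is given by a rotation system, i.e. for each vertex $v$ a cyclic order of the oriented edges starting at $v$. The faces of $G$ correspond to its facial walks, obtained by following an oriented edge $e$ and then continuing with the oriented edge that comes next after the inverse of $e$ in the rotational order; the size of a face is the length of its facial walk. The dual $G^*$ has the faces of $G$ as vertices and one edge $e^*$ for each edge $e$ of $G$, joining the (possibly equal) faces on the two sides of $e$; it is \emph{simple} if it has no loops and no multi-edges. A graph is \emph{$c$-connected} if it has more than $c$ vertices and removing any fewer than $c$ vertices leaves a connected graph. Corollary. Let $G$ be a map whose dual $G^*$ is simple. (1) If $G$ is $3$-connected and all faces of $G$ have size at most $4$ (e.g. $G$ is a quadrangulation), then $G^*$ is $3$-connected. (2) If $G$ is $5$-connected and all faces of $G$ have size at most $5$ (e.g. $G$ is a pentagulation), then $G^*$ is $3$-connected. -/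

import Mathlib

/-- A finite graph (loops and multi-edges allowed, no isolated vertices) cellularly embedded in a
closed orientable surface, given as a rotation system. The elements of `D` are the oriented edges
(darts); `rev` sends an oriented edge to its inverse; `rot` sends an oriented edge to the next one,
in the rotational order, among the oriented edges starting at the same vertex. -/
structure CombinatorialMap (D : Type*) where
  /-- The rotational order around the vertices. -/
  rot : Equiv.Perm D
  /-- Reversal of oriented edges. -/
  rev : Equiv.Perm D
  rev_rev : ∀ d, rev (rev d) = d
  rev_ne : ∀ d, rev d ≠ d

namespace CombinatorialMap

variable {D : Type*} (M : CombinatorialMap D)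

/-- The vertices are the cycles of the rotation. -/
def Vertex : Type _ := Quotient (Equiv.Perm.SameCycle.setoid M.rot)

/-- The vertex at which an oriented edge starts. -/
def src (d : D) : M.Vertex := Quotient.mk (Equiv.Perm.SameCycle.setoid M.rot) d

/-- The vertex at which an oriented edge ends. -/
def tgt (d : D) : M.Vertex := M.src (M.rev d)

/-- The embedded graph has no loops and no multi-edges. -/
def IsSimple : Prop :=
  (∀ d, M.src d ≠ M.tgt d) ∧ ∀ d e, M.src d = M.src e → M.tgt d = M.tgt e → d = e

/-- The underlying graph: two distinct vertices are adjacent if an oriented edge leads from one to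
the other. (For a map with `IsSimple` this forgets nothing about the abstract graph.) -/
def graph : SimpleGraph M.Vertex where
  Adj v w := v ≠ w ∧ ∃ d, M.src d = v ∧ M.tgt d = w
  symm := by
    refine ⟨?_⟩
    rintro v w ⟨hne, d, hv, hw⟩
    exact ⟨hne.symm, M.rev d, hw, by rw [tgt, M.rev_rev]; exact hv⟩
  loopless := ⟨fun _ h => h.1 rfl⟩

/-- One step along a facial walk: the edge following `d` is the next one in the rotational order
after the inverse of `d`. -/
def facePerm : Equiv.Perm D := M.rev.trans M.rot

/-- The dual map. Its vertices are the facial walks of `M`, its edges are in bijection with the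
edges of `M`: the dual of the oriented edge `d` leads from the face whose walk contains `d` to the
face whose walk contains the inverse of `d`. The order of the dual edges around a face is the order
in which they occur along its facial walk. -/
def dual : CombinatorialMap D where
  rot := M.facePerm
  rev := M.rev
  rev_rev := M.rev_rev
  rev_ne := M.rev_ne

/-- The faces of `M` are the vertices of the dual map. -/
abbrev Face : Type _ := M.dual.Vertex

/-- The size of a face: the length of its facial walk. (An edge that is traversed in both
directions counts twice.) -/
noncomputable def faceSize (f : M.Face) : ℕ := {d : D | M.dual.src d = f}.ncard

end CombinatorialMap

/-- A graph is `k`-connected if it has more than `k` vertices and the removal of fewer than `k`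
vertices always leaves a connected graph. -/
def SimpleGraph.IsKConnected {V : Type*} (G : SimpleGraph V) (k : ℕ) : Prop :=
  (k : ℕ∞) < ENat.card V ∧
    ∀ S : Finset V, S.card < k → (G.induce {v | v ∉ S}).Connected

/-!
Deleting fewer than three vertices of the dual can be reduced to deleting exactly two faces `f₁` and
`f₂`. Suppose this splits the other faces into two nonempty classes `A` and `B` with no edge between
them (`IsSeparation`). Since faces have size at most five and both the graph and its dual are
simple, no facial walk repeats a vertex (`src_injOn_face`). Call a vertex mixed if it is incident to
faces of both classes, and let `m` be the number of mixed vertices. Going round a mixed vertex, one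
passes from `A` to `B` and back only through angles of `f₁` and `f₂`; hence exactly one angle of
each occurs there, they are not consecutive, and they separate the `A`-angles from the `B`-angles.
Every other vertex is incident to only one of the classes, and an edge joining a vertex of the first
kind to one of the second is the unique common edge of `f₁` and `f₂`.

Thus the mixed vertices, together with one end of such a crossing edge if there is one, form a
vertex cut, provided that unmixed vertices of both kinds remain. If a crossing edge exists, then
connectivity gives `m ≥ k - 1`, as either end may be deleted and there are more than `k` vertices.
Otherwise it gives `m ≥ k`, since for `m ≤ 4` there are unmixed vertices of
both kinds (`exists_touches_not_touches`).

Large `m` is excluded by counting (`count`). At most `m (m - 1)` oriented edges join mixed vertices.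
If a face of size `s` contains all mixed vertices, then at least `2 m - s` of its oriented edges join
two of them, and one more does if some edge of the face avoids the mixed vertices. As `f₁` and `f₂`
have no common edge at a mixed vertex, their inner oriented edges and the inverses of these are all
different, so `4 (2 m - s) ≤ m (m - 1)`, or `4 (2 m - s + 1) ≤ m (m - 1)` with a crossing edge. For
`k = 3`, `s = 4` and for `k = 5`, `s = 5` this contradicts the lower bound on `m`, except when there
is no crossing edge and `m = k = s = 5`. In that case all vertices of `f₁` are mixed, so the faces
across its five edges alternate between `A` and `B`, which is impossible (`even_faceSize`).
-/

open Finset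

namespace CombinatorialMap

variable {D : Type*} {M : CombinatorialMap D}

/-! ### Darts, vertices and facial walks -/

theorem src_rot (d : D) : M.src (M.rot d) = M.src d :=
  Quotient.sound (s := Equiv.Perm.SameCycle.setoid M.rot)
    (Equiv.Perm.sameCycle_apply_left.2 (Equiv.Perm.SameCycle.refl M.rot d))

theorem tgt_rev (d : D) : M.tgt (M.rev d) = M.src d := by
  rw [tgt, M.rev_rev]

theorem src_facePerm (d : D) : M.src (M.facePerm d) = M.tgt d :=
  src_rot (M.rev d)

theorem dual_src_facePerm (d : D) : M.dual.src (M.facePerm d) = M.dual.src d :=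
  src_rot (M := M.dual) d

/-- The angle following an oriented edge `d` at its initial vertex lies on the other side of `d`. -/
theorem dual_src_rot (d : D) : M.dual.src (M.rot d) = M.dual.src (M.rev d) := by
  have h := dual_src_facePerm (M := M) (M.rev d)
  rwa [facePerm, Equiv.trans_apply, M.rev_rev] at h

theorem exists_iterate_rot_eq [Finite D] {a b : D} (h : M.src a = M.src b) :
    ∃ n : ℕ, M.rot^[n] a = b := by
  have h' : M.rot.SameCycle a b := Quotient.exact (s := Equiv.Perm.SameCycle.setoid M.rot) h
  obtain ⟨n, hn⟩ := h'.exists_nat_pow_eq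
  exact ⟨n, by rw [← hn, Equiv.Perm.iterate_eq_pow]⟩

/-- A property that persists under rotation around `v` passes between any two oriented edges
starting at `v`. -/
theorem of_rot_invariant [Finite D] {v : M.Vertex} (Q : D → Prop)
    (hQ : ∀ x, M.src x = v → Q x → Q (M.rot x)) {a b : D} (ha : M.src a = v) (hb : M.src b = v)
    (h : Q a) : Q b := by
  obtain ⟨n, rfl⟩ := exists_iterate_rot_eq (ha.trans hb.symm)
  suffices ∀ n : ℕ, M.src (M.rot^[n] a) = v ∧ Q (M.rot^[n] a) from (this n).2
  intro n
  induction n with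
  | zero => exact ⟨ha, h⟩
  | succ n ih =>
    rw [Function.iterate_succ_apply']
    exact ⟨(src_rot _).trans ih.1, hQ _ ih.1 ih.2⟩

theorem src_facePerm_ne (hM : M.IsSimple) (d : D) : M.src (M.facePerm d) ≠ M.src d := by
  rw [src_facePerm]
  exact (hM.1 d).symm

/-- A facial walk does not return to a vertex after two steps: otherwise it would traverse an edge
back and forth, and the dual edge would be a loop. -/
theorem src_facePerm_facePerm_ne (hM : M.IsSimple) (hM' : M.dual.IsSimple) (d : D) :
    M.src (M.facePerm (M.facePerm d)) ≠ M.src d := by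
  intro h
  rw [src_facePerm] at h
  have : M.facePerm d = M.rev d :=
    hM.2 _ _ (src_facePerm d) (h.trans (tgt_rev d).symm)
  exact hM'.1 d ((dual_src_facePerm d).symm.trans (congrArg M.dual.src this))

/-- The dual counterpart of `src_facePerm_facePerm_ne`: the angles at a vertex that are two steps
apart lie in different faces. -/
theorem dual_src_rot_rot_ne (hM : M.IsSimple) (hM' : M.dual.IsSimple) (d : D) :
    M.dual.src (M.rot (M.rot d)) ≠ M.dual.src d := by
  intro h
  have h1 : M.rot d = M.rev d := by
    refine hM'.2 _ _ (dual_src_rot d) ?_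
    exact (dual_src_rot (M.rot d)).symm.trans (h.trans (tgt_rev (M := M.dual) d).symm)
  exact hM.1 d ((src_rot d).symm.trans (congrArg M.src h1))

theorem dual_src_rot_ne (hM' : M.dual.IsSimple) (d : D) :
    M.dual.src (M.rot d) ≠ M.dual.src d := by
  rw [dual_src_rot]
  exact (hM'.1 d).symm

/-- A facial walk of length at most five does not visit a vertex twice: two visits would be at most
two steps apart along one of the two arcs of the walk. -/
theorem src_injOn_face [Finite D] (hM : M.IsSimple) (hM' : M.dual.IsSimple)
    (hs : ∀ f : M.Face, M.faceSize f ≤ 5) {d e : D} (hf : M.dual.src d = M.dual.src e)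
    (hv : M.src d = M.src e) : d = e := by
  set n := Function.minimalPeriod M.facePerm d with hn
  have hpos : 0 < n :=
    Function.minimalPeriod_pos_of_mem_periodicPts
      (M.facePerm.injective.mem_periodicPts d)
  have hper : M.facePerm^[n] d = d := Function.iterate_minimalPeriod
  have hsrc : ∀ k : ℕ, M.dual.src (M.facePerm^[k] d) = M.dual.src d := by
    intro k
    induction k with
    | zero => rfl
    | succ k ih => rw [Function.iterate_succ_apply', dual_src_facePerm, ih]
  have hn5 : n ≤ 5 := by
    refine le_trans ?_ (hs (M.dual.src d))
    have hsub : (fun k => M.facePerm^[k] d) '' Set.Iio n ⊆ {x | M.dual.src x = M.dual.src d} := by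
      rintro _ ⟨k, -, rfl⟩
      exact hsrc k
    have := Set.ncard_le_ncard hsub (Set.toFinite _)
    rwa [Function.iterate_injOn_Iio_minimalPeriod.ncard_image,
      Set.ncard_eq_toFinset_card', Set.toFinset_Iio, Nat.card_Iio] at this
  obtain ⟨k, hk⟩ := exists_iterate_rot_eq (M := M.dual) hf
  change M.facePerm^[k] d = e at hk
  rw [← Function.iterate_mod_minimalPeriod_eq] at hk
  have hlt : k % n < n := Nat.mod_lt _ hpos
  rw [← hn] at hk
  generalize k % n = i at hk hlt
  obtain ⟨j, hj⟩ : ∃ j, n = j + i := ⟨n - i, by omega⟩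
  have hback : M.facePerm^[j] e = d := by
    rw [← hk, ← Function.iterate_add_apply, ← hj, hper]
  have h2 := src_facePerm_facePerm_ne hM hM'
  have h1 := src_facePerm_ne hM
  have hi : i = 0 ∨ i = 1 ∨ i = 2 ∨ j = 1 ∨ j = 2 := by omega
  rcases hi with rfl | rfl | rfl | rfl | rfl
  · exact hk
  · exact absurd ((congrArg M.src hk).trans hv.symm) (h1 d)
  · exact absurd ((congrArg M.src hk).trans hv.symm) (h2 d)
  · exact absurd ((congrArg M.src hback).trans hv) (h1 e)
  · exact absurd ((congrArg M.src hback).trans hv) (h2 e)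

/-! ### Separations of the dual by two faces -/

/-- The faces other than `f₁` and `f₂` are divided into two nonempty classes `A` and `B` such that
no edge has a face of `A` on one side and a face of `B` on the other: deleting `f₁` and `f₂`
disconnects the dual. -/
structure IsSeparation (M : CombinatorialMap D) (f₁ f₂ : M.Face) (A B : Set M.Face) : Prop where
  ne : f₁ ≠ f₂
  cover : ∀ f, (f = f₁ ∨ f = f₂) ∨ f ∈ A ∨ f ∈ B
  disjoint : ∀ f ∈ A, f ∉ B
  left : ∀ f ∈ A, ¬(f = f₁ ∨ f = f₂)
  right : ∀ f ∈ B, ¬(f = f₁ ∨ f = f₂)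
  nonadj : ∀ d, M.dual.src d ∈ A → M.dual.src (M.rev d) ∉ B
  nonempty_left : A.Nonempty
  nonempty_right : B.Nonempty

/-- The vertex `v` is incident to a face of the class `A`. -/
def Touches (M : CombinatorialMap D) (A : Set M.Face) (v : M.Vertex) : Prop :=
  ∃ d, M.src d = v ∧ M.dual.src d ∈ A

namespace IsSeparation

variable {f₁ f₂ : M.Face} {A B : Set M.Face}

theorem symm (h : M.IsSeparation f₁ f₂ A B) : M.IsSeparation f₁ f₂ B A where
  ne := h.ne
  cover f := (h.cover f).imp id Or.symm
  disjoint f hB hA := h.disjoint f hA hB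
  left := h.right
  right := h.left
  nonadj d hB hA := h.nonadj (M.rev d) hA (by rwa [M.rev_rev])
  nonempty_left := h.nonempty_right
  nonempty_right := h.nonempty_left

theorem exists_rot_symm_mem [Finite D] (h : M.IsSeparation f₁ f₂ A B) {v : M.Vertex}
    (hA : M.Touches A v) (hB : M.Touches B v) :
    ∃ e, M.src e = v ∧ (M.dual.src e = f₁ ∨ M.dual.src e = f₂) ∧
      M.dual.src (M.rot.symm e) ∈ A := by
  obtain ⟨a, ha, haA⟩ := hA
  obtain ⟨b, hb, hbB⟩ := hB
  by_contra! hne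
  refine h.disjoint _ (of_rot_invariant (fun x => M.dual.src x ∈ A) ?_ ha hb haA) hbB
  intro x hx hxA
  rcases h.cover (M.dual.src (M.rot x)) with hS | hA | hB
  · exact absurd (by rwa [Equiv.symm_apply_apply]) (hne (M.rot x) ((src_rot x).trans hx) hS)
  · exact hA
  · exact absurd (dual_src_rot x ▸ hB) (h.nonadj x hxA)

theorem exists_rot_mem [Finite D] (h : M.IsSeparation f₁ f₂ A B) {v : M.Vertex}
    (hA : M.Touches A v) (hB : M.Touches B v) :
    ∃ e, M.src e = v ∧ (M.dual.src e = f₁ ∨ M.dual.src e = f₂) ∧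
      M.dual.src (M.rot e) ∈ A := by
  obtain ⟨a, ha, haA⟩ := hA
  obtain ⟨b, hb, hbB⟩ := hB
  by_contra! hne
  refine of_rot_invariant (fun x => M.dual.src x ∉ A) ?_ hb ha
    (fun hbA => h.disjoint _ hbA hbB) haA
  intro x hx hxA hxA'
  rcases h.cover (M.dual.src x) with hS | hA | hB
  · exact hne x hx hS hxA'
  · exact hxA hA
  · exact h.symm.nonadj x hB (dual_src_rot x ▸ hxA')

/-- If no face has two angles at a vertex, two different angles at `v` in `f₁` or `f₂` are the only
ones. -/
theorem eq_or_eq (hinj : ∀ d e, M.dual.src d = M.dual.src e → M.src d = M.src e → d = e)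
    {v : M.Vertex} {e x y : D} (he : M.src e = v)
    (hx : M.src x = v) (hy : M.src y = v) (hxy : x ≠ y)
    (heS : M.dual.src e = f₁ ∨ M.dual.src e = f₂) (hxS : M.dual.src x = f₁ ∨ M.dual.src x = f₂)
    (hyS : M.dual.src y = f₁ ∨ M.dual.src y = f₂) : e = x ∨ e = y := by
  have h1 : M.dual.src x ≠ M.dual.src y := fun hf => hxy (hinj _ _ hf (hx.trans hy.symm))
  have : M.dual.src e = M.dual.src x ∨ M.dual.src e = M.dual.src y := by
    rcases heS with a | a <;> rcases hxS with b | b <;> rcases hyS with c | c <;> simp_all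
  exact this.imp (fun hf => hinj _ _ hf (he.trans hx.symm))
    (fun hf => hinj _ _ hf (he.trans hy.symm))

variable [Finite D] (hinj : ∀ d e, M.dual.src d = M.dual.src e → M.src d = M.src e → d = e)

include hinj

/-- A vertex incident to both classes is incident to `f₁` and to `f₂`. -/
theorem exists_dart (h : M.IsSeparation f₁ f₂ A B) {v : M.Vertex}
    (hA : M.Touches A v) (hB : M.Touches B v) {f : M.Face} (hf : f = f₁ ∨ f = f₂) :
    ∃ e, M.src e = v ∧ M.dual.src e = f := by
  obtain ⟨x, hx, hxS, hxA⟩ := h.exists_rot_symm_mem hA hB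
  obtain ⟨y, hy, hyS, hyB⟩ := h.symm.exists_rot_symm_mem hB hA
  have hxy : M.dual.src x ≠ M.dual.src y := by
    intro hf
    rw [hinj _ _ hf (hx.trans hy.symm)] at hxA
    exact h.disjoint _ hxA hyB
  by_contra! hne
  have h1 := hne x hx
  have h2 := hne y hy
  rcases hf with a | a <;> rcases hxS with b | b <;> rcases hyS with c | c <;> simp_all

/-- At a vertex incident to both classes, the angle after one in `f₁` or `f₂` is in neither. -/
theorem rot_notMem (h : M.IsSeparation f₁ f₂ A B) {e : D}
    (hA : M.Touches A (M.src e)) (hB : M.Touches B (M.src e))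
    (he : M.dual.src e = f₁ ∨ M.dual.src e = f₂) :
    ¬(M.dual.src (M.rev e) = f₁ ∨ M.dual.src (M.rev e) = f₂) := by
  obtain ⟨x, hx, hxS, hxA⟩ := h.exists_rot_mem hA hB
  obtain ⟨y, hy, hyS, hyB⟩ := h.symm.exists_rot_mem hB hA
  have hxy : x ≠ y := by
    rintro rfl
    exact h.disjoint _ hxA hyB
  rw [← dual_src_rot]
  rcases eq_or_eq hinj rfl hx hy hxy he hxS hyS with rfl | rfl
  · exact h.left _ hxA
  · exact h.right _ hyB

theorem rot_symm_notMem (h : M.IsSeparation f₁ f₂ A B) {e : D}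
    (hA : M.Touches A (M.src e)) (hB : M.Touches B (M.src e))
    (he : M.dual.src e = f₁ ∨ M.dual.src e = f₂) :
    ¬(M.dual.src (M.rot.symm e) = f₁ ∨ M.dual.src (M.rot.symm e) = f₂) := by
  obtain ⟨x, hx, hxS, hxA⟩ := h.exists_rot_symm_mem hA hB
  obtain ⟨y, hy, hyS, hyB⟩ := h.symm.exists_rot_symm_mem hB hA
  have hxy : x ≠ y := by
    rintro rfl
    exact h.disjoint _ hxA hyB
  rcases eq_or_eq hinj rfl hx hy hxy he hxS hyS with rfl | rfl
  · exact h.left _ hxA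
  · exact h.right _ hyB

/-- At a vertex incident to both classes, the two angles next to one in `f₁` or `f₂` are not in the
same class: otherwise rotation could leave the class only through the single angle in the other one
of `f₁` and `f₂`, which is entered from the opposite class. -/
theorem rot_symm_notMem_of_rot_mem (h : M.IsSeparation f₁ f₂ A B) {e : D}
    (hA : M.Touches A (M.src e)) (hB : M.Touches B (M.src e))
    (he : M.dual.src e = f₁ ∨ M.dual.src e = f₂) (hr : M.dual.src (M.rot e) ∈ A) :
    M.dual.src (M.rot.symm e) ∉ A := by
  intro hs
  obtain ⟨y, hy, hyS, hyB⟩ := h.symm.exists_rot_symm_mem hB hA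
  have hey : e ≠ y := by
    rintro rfl
    exact h.disjoint _ hs hyB
  obtain ⟨a, ha, haA⟩ := hA
  obtain ⟨b, hb, hbB⟩ := id hB
  have key : M.dual.src b ∈ A ∨ b = e := by
    refine of_rot_invariant (fun x => M.dual.src x ∈ A ∨ x = e) ?_ ha hb (Or.inl haA)
    rintro x hx (hxA | rfl)
    · rcases h.cover (M.dual.src (M.rot x)) with hS | hA' | hB'
      · rcases eq_or_eq hinj ((src_rot x).trans hx) rfl hy hey hS he hyS with h1 | h1
        · exact Or.inr h1
        · rw [← h1, Equiv.symm_apply_apply] at hyB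
          exact absurd hyB (h.disjoint _ hxA)
      · exact Or.inl hA'
      · exact absurd (dual_src_rot x ▸ hB') (h.nonadj x hxA)
    · exact Or.inl hr
  rcases key with h1 | rfl
  · exact h.disjoint _ h1 hbB
  · exact h.right _ hbB he

end IsSeparation

namespace IsSeparation

variable {f₁ f₂ : M.Face} {A B : Set M.Face}

/-- An edge joining a vertex incident to `A` but not `B` to a vertex incident to `B` but not `A` is
a common edge of `f₁` and `f₂`, since both its sides are incident to both its ends. -/
theorem sides_of_crossing (h : M.IsSeparation f₁ f₂ A B)
    {d : D} (h1 : ¬M.Touches B (M.src d)) (h2 : ¬M.Touches A (M.tgt d)) :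
    (M.dual.src d = f₁ ∨ M.dual.src d = f₂) ∧
      (M.dual.src (M.rev d) = f₁ ∨ M.dual.src (M.rev d) = f₂) := by
  constructor
  · refine (h.cover _).resolve_right ?_
    rintro (hA | hB)
    · exact h2 ⟨M.facePerm d, src_facePerm d, (dual_src_facePerm d).symm ▸ hA⟩
    · exact h1 ⟨d, rfl, hB⟩
  · refine (h.cover _).resolve_right ?_
    rintro (hA | hB)
    · exact h2 ⟨M.rev d, rfl, hA⟩
    · exact h1 ⟨M.rot d, src_rot d, (dual_src_rot d).symm ▸ hB⟩

/-- At most one edge joins a vertex not incident to `B` to a vertex not incident to `A`, as `f₁`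
and `f₂` have at most one common edge. -/
theorem crossing_unique (hM' : M.dual.IsSimple) {f₁ f₂ : M.Face} {A B : Set M.Face}
    (h : M.IsSeparation f₁ f₂ A B) {d e : D} (hd1 : ¬M.Touches B (M.src d))
    (hd2 : ¬M.Touches A (M.tgt d)) (he1 : ¬M.Touches B (M.src e)) (he2 : ¬M.Touches A (M.tgt e))
    (hd : M.Touches A (M.src d)) : d = e := by
  obtain ⟨a, b⟩ := h.sides_of_crossing hd1 hd2
  obtain ⟨a', b'⟩ := h.sides_of_crossing he1 he2
  have hd' : M.dual.src d ≠ M.dual.src (M.rev d) := hM'.1 d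
  have he' : M.dual.src e ≠ M.dual.src (M.rev e) := hM'.1 e
  by_cases hde : M.dual.src d = M.dual.src e
  · refine hM'.2 _ _ hde ?_
    change M.dual.src (M.rev d) = M.dual.src (M.rev e)
    rcases a with a | a <;> rcases b with b | b <;> rcases a' with a' | a' <;>
      rcases b' with b' | b' <;> simp_all
  · have : d = M.rev e := by
      refine hM'.2 _ _ ?_ ?_
      · rcases a with a | a <;> rcases b with b | b <;> rcases a' with a' | a' <;>
          rcases b' with b' | b' <;> simp_all
      · rw [show M.rev e = M.dual.rev e from rfl, tgt_rev (M := M.dual)]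
        change M.dual.src (M.rev d) = M.dual.src e
        rcases a with a | a <;> rcases b with b | b <;> rcases a' with a' | a' <;>
          rcases b' with b' | b' <;> simp_all
    exact absurd (by rwa [this] at hd) he2

theorem touches_or (hM : M.IsSimple) (hM' : M.dual.IsSimple) {f₁ f₂ : M.Face} {A B : Set M.Face}
    (h : M.IsSeparation f₁ f₂ A B) (v : M.Vertex) : M.Touches A v ∨ M.Touches B v := by
  obtain ⟨d, rfl⟩ := Quotient.exists_rep v
  change M.Touches A (M.src d) ∨ M.Touches B (M.src d)
  have h1 := dual_src_rot_ne hM' d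
  have h2 := dual_src_rot_ne hM' (M.rot d)
  have h3 := dual_src_rot_rot_ne hM hM' d
  have key : ∃ e, M.src e = M.src d ∧ ¬(M.dual.src e = f₁ ∨ M.dual.src e = f₂) := by
    by_contra! hne
    have a := hne d rfl
    have b := hne (M.rot d) (src_rot d)
    have c := hne (M.rot (M.rot d)) ((src_rot _).trans (src_rot d))
    rcases a with a | a <;> rcases b with b | b <;> rcases c with c | c <;> simp_all
  obtain ⟨e, he, heS⟩ := key
  exact ((h.cover _).resolve_left heS).imp (fun x => ⟨e, he, x⟩) (fun x => ⟨e, he, x⟩)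

/-- A face has at least three neighbours in the dual, hence one other than `f₁` and `f₂`. -/
theorem exists_rev_mem (hM : M.IsSimple) (hM' : M.dual.IsSimple)
    (h : M.IsSeparation f₁ f₂ A B) {g : M.Face} (hg : g ∈ A) :
    ∃ d, M.dual.src d = g ∧ M.dual.src (M.rev d) ∈ A := by
  obtain ⟨d, rfl⟩ := Quotient.exists_rep g
  change M.dual.src d ∈ A at hg
  change ∃ e, M.dual.src e = M.dual.src d ∧ _
  have hne : ∀ x y, M.dual.src x = M.dual.src d → M.dual.src y = M.dual.src d →
      M.src x ≠ M.src y → M.dual.src (M.rev x) ≠ M.dual.src (M.rev y) :=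
    fun x y hx hy hxy he => hxy (congrArg M.src (hM'.2 x y (hx.trans hy.symm) he))
  have f1 := dual_src_facePerm (M := M) d
  have f2 := (dual_src_facePerm (M := M) (M.facePerm d)).trans f1
  have h1 := hne _ _ f1 rfl (src_facePerm_ne hM d)
  have h2 := hne _ _ f2 f1 (src_facePerm_ne hM _)
  have h3 := hne _ _ f2 rfl (src_facePerm_facePerm_ne hM hM' d)
  have key : ∃ e, M.dual.src e = M.dual.src d ∧
      ¬(M.dual.src (M.rev e) = f₁ ∨ M.dual.src (M.rev e) = f₂) := by
    by_contra! hne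
    have a := hne d rfl
    have b := hne _ f1
    have c := hne _ f2
    rcases a with a | a <;> rcases b with b | b <;> rcases c with c | c <;> simp_all
  obtain ⟨e, he, heS⟩ := key
  refine ⟨e, he, ((h.cover _).resolve_left heS).resolve_right (h.nonadj e (he ▸ hg))⟩

end IsSeparation

/-- Fewer than `k` vertices do not separate a `k`-connected graph. -/
theorem of_isKConnected {k : ℕ} (hk : M.graph.IsKConnected k) {T : Finset M.Vertex}
    (hT : #T < k) (P : M.Vertex → Prop)
    (hP : ∀ d, M.src d ∉ T → M.tgt d ∉ T → P (M.src d) → P (M.tgt d)) {x y : M.Vertex}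
    (hx : x ∉ T) (hy : y ∉ T) (hPx : P x) : P y := by
  obtain ⟨w⟩ := (hk.2 T hT).preconnected ⟨x, hx⟩ ⟨y, hy⟩
  suffices ∀ a b : {v | v ∉ T}, (M.graph.induce {v | v ∉ T}).Walk a b → P a → P b from
    this _ _ w hPx
  intro a b w
  induction w with
  | nil => exact id
  | @cons u v _ huv _ ih =>
    obtain ⟨-, d, hd1, hd2⟩ := huv
    intro hu
    refine ih ?_
    have := hP d (by rw [hd1]; exact u.2) (by rw [hd2]; exact v.2)
    rw [hd1, hd2] at this
    exact this hu

/-! ### Counting oriented edges between vertices of a finite set -/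

section Counting

open scoped Classical

/-- In a simple graph, at most `|W| (|W| - 1)` oriented edges have both ends in `W`. -/
theorem card_add_card_le_mul (hM : M.IsSimple) {W : Finset M.Vertex} {T : Finset D}
    (hT : ∀ d ∈ T, M.src d ∈ W ∧ M.tgt d ∈ W) : #T + #W ≤ #W * #W := by
  have h : #T ≤ #W.offDiag := by
    refine card_le_card_of_injOn (fun d => (M.src d, M.tgt d)) ?_ ?_
    · intro d hd
      exact mem_offDiag.2 ⟨(hT d hd).1, (hT d hd).2, hM.1 d⟩
    · intro d _ e _ hde
      exact hM.2 _ _ (congrArg Prod.fst hde) (congrArg Prod.snd hde)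
  rw [offDiag_card] at h
  have : #W ≤ #W * #W := Nat.le_mul_self _
  omega

variable [Fintype D]

/-- The oriented edges whose left side is the face `f`. -/
noncomputable def faceDarts (M : CombinatorialMap D) (f : M.Face) : Finset D :=
  {d | M.dual.src d = f}

/-- The oriented edges of `f` with both ends in `W`. -/
noncomputable def innerDarts (M : CombinatorialMap D) (f : M.Face) (W : Finset M.Vertex) :
    Finset D :=
  {d ∈ M.faceDarts f | M.src d ∈ W ∧ M.tgt d ∈ W}

/-- The oriented edges of `f` with no end in `W`. -/
noncomputable def outerDarts (M : CombinatorialMap D) (f : M.Face) (W : Finset M.Vertex) :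
    Finset D :=
  {d ∈ M.faceDarts f | M.src d ∉ W ∧ M.tgt d ∉ W}

theorem mem_faceDarts {f : M.Face} {d : D} : d ∈ M.faceDarts f ↔ M.dual.src d = f := by
  simp [faceDarts]

theorem card_faceDarts (f : M.Face) : #(M.faceDarts f) = M.faceSize f := by
  rw [faceSize, Set.ncard_eq_toFinset_card']
  congr 1
  ext d
  simp [faceDarts]

theorem three_le_card_faceDarts (hM : M.IsSimple) (hM' : M.dual.IsSimple) (f : M.Face) :
    3 ≤ #(M.faceDarts f) := by
  obtain ⟨d, rfl⟩ := Quotient.exists_rep f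
  change 3 ≤ #(M.faceDarts (M.dual.src d))
  have h1 := src_facePerm_ne hM d
  have h2 := src_facePerm_ne hM (M.facePerm d)
  have h3 := src_facePerm_facePerm_ne hM hM' d
  have hc : #{d, M.facePerm d, M.facePerm (M.facePerm d)} = 3 :=
    card_eq_three.2 ⟨_, _, _, fun e => h1 (congrArg M.src e.symm),
      fun e => h3 (congrArg M.src e.symm), fun e => h2 (congrArg M.src e.symm), rfl⟩
  rw [← hc]
  refine card_le_card fun x hx => ?_
  simp only [mem_insert, mem_singleton] at hx
  rw [mem_faceDarts]
  rcases hx with rfl | rfl | rfl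
  · rfl
  · exact dual_src_facePerm d
  · exact (dual_src_facePerm _).trans (dual_src_facePerm d)

/-- Each vertex of `W` is both the start and the end of an oriented edge of `f`; an oriented edge is
counted twice exactly if it is inner, and not at all exactly if it is outer. -/
theorem two_mul_card_add_le {f : M.Face} {W : Finset M.Vertex}
    (hW : ∀ v ∈ W, ∃ d, M.src d = v ∧ M.dual.src d = f) :
    2 * #W + #(M.outerDarts f W) ≤ #(M.innerDarts f W) + #(M.faceDarts f) := by
  set X : Finset D := {d ∈ M.faceDarts f | M.src d ∈ W} with hX
  set Y : Finset D := {d ∈ M.faceDarts f | M.tgt d ∈ W} with hY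
  have h1 : #W ≤ #X := by
    refine card_le_card_of_surjOn M.src ?_
    intro v hv
    obtain ⟨d, hd, hf⟩ := hW v hv
    exact ⟨d, by simpa [hX, mem_faceDarts, hf, hd] using hv, hd⟩
  have h2 : #W ≤ #Y := by
    refine card_le_card_of_surjOn M.tgt ?_
    intro v hv
    obtain ⟨d, hd, hf⟩ := hW v hv
    have e1 : M.tgt (M.facePerm.symm d) = v := by
      rw [← src_facePerm, Equiv.apply_symm_apply, hd]
    have e2 : M.dual.src (M.facePerm.symm d) = f := by
      rw [← dual_src_facePerm, Equiv.apply_symm_apply, hf]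
    exact ⟨M.facePerm.symm d, by simpa [hY, mem_faceDarts, e2, e1] using hv, e1⟩
  have h3 : X ∩ Y = M.innerDarts f W := by
    ext d
    simp only [hX, hY, innerDarts, mem_inter, mem_filter]
    tauto
  have h4 : #(X ∪ Y) + #(M.outerDarts f W) ≤ #(M.faceDarts f) := by
    rw [← card_union_of_disjoint]
    · refine card_le_card fun d hd => ?_
      simp only [hX, hY, outerDarts, mem_union, mem_filter] at hd
      tauto
    · rw [disjoint_left]
      intro d hd
      simp only [hX, hY, outerDarts, mem_union, mem_filter] at hd ⊢
      tauto
  have h5 := card_union_add_card_inter X Y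
  rw [h3] at h5
  omega

/-- The vertices incident to faces of both classes. -/
noncomputable def mixed (M : CombinatorialMap D) (A B : Set M.Face) : Finset M.Vertex :=
  {v ∈ univ.image M.src | M.Touches A v ∧ M.Touches B v}

theorem mem_mixed {A B : Set M.Face} {v : M.Vertex} :
    v ∈ M.mixed A B ↔ M.Touches A v ∧ M.Touches B v := by
  simp only [mixed, mem_filter, and_iff_right_iff_imp]
  rintro ⟨⟨d, rfl, -⟩, -⟩
  exact mem_image_of_mem _ (mem_univ d)

theorem mixed_comm (A B : Set M.Face) : M.mixed A B = M.mixed B A := by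
  ext v
  rw [mem_mixed, mem_mixed, and_comm]

namespace IsSeparation

variable {f₁ f₂ : M.Face} {A B : Set M.Face}

/-- The basic count. The inner oriented edges of `f₁` and `f₂` and their inverses are all distinct,
because `f₁` and `f₂` share no edge at a mixed vertex; `X` consists of further oriented edges
between mixed vertices. -/
theorem count (hM : M.IsSimple)
    (hinj : ∀ d e, M.dual.src d = M.dual.src e → M.src d = M.src e → d = e)
    (h : M.IsSeparation f₁ f₂ A B) (X : Finset D)
    (hX : ∀ d ∈ X, (M.src d ∈ M.mixed A B ∧ M.tgt d ∈ M.mixed A B) ∧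
      ¬(M.dual.src d = f₁ ∨ M.dual.src d = f₂) ∧
      ¬(M.dual.src (M.rev d) = f₁ ∨ M.dual.src (M.rev d) = f₂)) :
    9 * #(M.mixed A B) + 2 * #(M.outerDarts f₁ (M.mixed A B)) +
      2 * #(M.outerDarts f₂ (M.mixed A B)) + #X ≤
      #(M.mixed A B) * #(M.mixed A B) + 2 * M.faceSize f₁ + 2 * M.faceSize f₂ := by
  set W := M.mixed A B with hW
  have hv : ∀ f, f = f₁ ∨ f = f₂ → ∀ v ∈ W, ∃ d, M.src d = v ∧ M.dual.src d = f := by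
    intro f hf v hv
    obtain ⟨hA, hB⟩ := mem_mixed.1 hv
    exact h.exists_dart hinj hA hB hf
  have c1 := two_mul_card_add_le (hv f₁ (Or.inl rfl))
  have c2 := two_mul_card_add_le (hv f₂ (Or.inr rfl))
  rw [card_faceDarts] at c1 c2
  set T := M.innerDarts f₁ W ∪ M.innerDarts f₂ W with hT
  have memT : ∀ d, d ∈ T ↔ (M.dual.src d = f₁ ∨ M.dual.src d = f₂) ∧ M.src d ∈ W ∧
      M.tgt d ∈ W := by
    intro d
    simp only [hT, innerDarts, mem_union, mem_filter, mem_faceDarts]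
    tauto
  have cT : #T = #(M.innerDarts f₁ W) + #(M.innerDarts f₂ W) := by
    refine card_union_of_disjoint (disjoint_left.2 fun d h1 h2 => h.ne ?_)
    simp only [innerDarts, mem_filter, mem_faceDarts] at h1 h2
    exact h1.1.symm.trans h2.1
  have memR : ∀ d, d ∈ T.map M.rev.toEmbedding ↔ (M.dual.src (M.rev d) = f₁ ∨
      M.dual.src (M.rev d) = f₂) ∧ M.src d ∈ W ∧ M.tgt d ∈ W := by
    intro d
    have : M.rev.symm d = M.rev d := by rw [Equiv.symm_apply_eq, M.rev_rev]
    rw [mem_map_equiv, this, memT, tgt_rev]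
    exact and_congr_right fun _ => and_comm
  have hd1 : Disjoint T (T.map M.rev.toEmbedding) := by
    refine disjoint_left.2 fun d h1 h2 => ?_
    obtain ⟨hS, hs, -⟩ := (memT d).1 h1
    obtain ⟨hA, hB⟩ := mem_mixed.1 hs
    exact h.rot_notMem hinj hA hB hS ((memR d).1 h2).1
  have hd2 : Disjoint (T ∪ T.map M.rev.toEmbedding) X := by
    refine disjoint_left.2 fun d h1 h2 => ?_
    obtain ⟨-, n1, n2⟩ := hX d h2
    rcases mem_union.1 h1 with h1 | h1
    · exact n1 ((memT d).1 h1).1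
    · exact n2 ((memR d).1 h1).1
  have tot := card_add_card_le_mul hM (W := W) (T := T ∪ T.map M.rev.toEmbedding ∪ X) (by
    intro d hd
    rcases mem_union.1 hd with hd | hd
    · rcases mem_union.1 hd with hd | hd
      · exact ((memT d).1 hd).2
      · exact ((memR d).1 hd).2
    · exact (hX d hd).1)
  rw [card_union_of_disjoint hd2, card_union_of_disjoint hd1, card_map] at tot
  omega

theorem card_mixed_le (hinj : ∀ d e, M.dual.src d = M.dual.src e → M.src d = M.src e → d = e)
    (h : M.IsSeparation f₁ f₂ A B) : #(M.mixed A B) ≤ M.faceSize f₁ := by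
  have c := two_mul_card_add_le (f := f₁) (W := M.mixed A B) (fun v hv =>
    h.exists_dart hinj (mem_mixed.1 hv).1 (mem_mixed.1 hv).2 (Or.inl rfl))
  have : #(M.innerDarts f₁ (M.mixed A B)) ≤ #(M.faceDarts f₁) := card_filter_le _ _
  rw [card_faceDarts] at c this
  omega

/-- If all vertices of `f₁` are mixed, then along `f₁` the faces on the other side are alternately
in `A` and in `B`, so the size of `f₁` is even. -/
theorem even_faceSize (hinj : ∀ d e, M.dual.src d = M.dual.src e → M.src d = M.src e → d = e)
    (h : M.IsSeparation f₁ f₂ A B)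
    (hall : ∀ d, M.dual.src d = f₁ → M.src d ∈ M.mixed A B) : Even (M.faceSize f₁) := by
  have step : ∀ d, M.dual.src d = f₁ → (M.dual.src (M.rev (M.facePerm d)) ∈ A ↔
      M.dual.src (M.rev d) ∉ A) := by
    intro d hd
    have hd' : M.dual.src (M.facePerm d) = f₁ := (dual_src_facePerm d).trans hd
    obtain ⟨hA, hB⟩ := mem_mixed.1 (hall _ hd')
    have e : M.rot.symm (M.facePerm d) = M.rev d := by
      rw [facePerm, Equiv.trans_apply, Equiv.symm_apply_apply]
    have s1 := h.rot_symm_notMem_of_rot_mem hinj hA hB (Or.inl hd')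
    have s2 := h.symm.rot_symm_notMem_of_rot_mem hinj hB hA (Or.inl hd')
    have s3 := h.rot_notMem hinj hA hB (Or.inl hd')
    have s4 := h.rot_symm_notMem hinj hA hB (Or.inl hd')
    rw [e] at s1 s2 s4
    rw [dual_src_rot] at s1 s2
    have c3 := (h.cover _).resolve_left s3
    have c4 := (h.cover _).resolve_left s4
    have := h.disjoint (M.dual.src (M.rev d))
    tauto
  set P : Finset D := {d ∈ M.faceDarts f₁ | M.dual.src (M.rev d) ∈ A} with hP
  set N : Finset D := {d ∈ M.faceDarts f₁ | M.dual.src (M.rev d) ∉ A} with hN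
  have hsum : #P + #N = #(M.faceDarts f₁) := card_filter_add_card_filter_not _
  have h1 : #P ≤ #N := by
    refine card_le_card_of_injOn M.facePerm ?_ M.facePerm.injective.injOn
    intro d hd
    simp only [hP, hN, coe_filter, Set.mem_ofPred_eq, mem_faceDarts] at hd ⊢
    exact ⟨(dual_src_facePerm d).trans hd.1, fun hc => (step d hd.1).1 hc hd.2⟩
  have h2 : #N ≤ #P := by
    refine card_le_card_of_injOn M.facePerm ?_ M.facePerm.injective.injOn
    intro d hd
    simp only [hP, hN, coe_filter, Set.mem_ofPred_eq, mem_faceDarts] at hd ⊢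
    exact ⟨(dual_src_facePerm d).trans hd.1, (step d hd.1).2 hd.2⟩
  rw [← card_faceDarts]
  exact ⟨#P, by omega⟩

theorem card_mixed_ne_five
    (hinj : ∀ d e, M.dual.src d = M.dual.src e → M.src d = M.src e → d = e)
    (h : M.IsSeparation f₁ f₂ A B) (hs : M.faceSize f₁ ≤ 5) : #(M.mixed A B) ≠ 5 := by
  intro h5
  have hle := h.card_mixed_le hinj
  have heq : M.faceSize f₁ = 5 := by omega
  have himg : M.mixed A B = (M.faceDarts f₁).image M.src := by
    refine eq_of_subset_of_card_le ?_ ?_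
    · intro v hv
      obtain ⟨d, hd, hf⟩ := h.exists_dart hinj (mem_mixed.1 hv).1 (mem_mixed.1 hv).2 (Or.inl rfl)
      exact mem_image.2 ⟨d, mem_faceDarts.2 hf, hd⟩
    · refine card_image_le.trans ?_
      rw [card_faceDarts, heq, h5]
  have hev := h.even_faceSize hinj (fun d hd => by
    rw [himg]
    exact mem_image_of_mem _ (mem_faceDarts.2 hd))
  rw [heq] at hev
  exact absurd hev (by decide)

/-- At most four mixed vertices do not suffice to contain all vertices of the faces of `A`. Two
adjacent faces of `A` supply six oriented edges between mixed vertices, in addition to those of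
`f₁`; and an edge common to them is in neither `f₁` nor `f₂`. -/
theorem exists_touches_not_touches (hM : M.IsSimple) (hM' : M.dual.IsSimple)
    (hinj : ∀ d e, M.dual.src d = M.dual.src e → M.src d = M.src e → d = e)
    (hs : ∀ f : M.Face, M.faceSize f ≤ 5) (h : M.IsSeparation f₁ f₂ A B)
    (hm : #(M.mixed A B) ≤ 4) : ∃ v, M.Touches A v ∧ ¬M.Touches B v := by
  by_contra! hAB
  have hsrc : ∀ d, M.dual.src d ∈ A → M.src d ∈ M.mixed A B := fun d hd =>
    mem_mixed.2 ⟨⟨d, rfl, hd⟩, hAB _ ⟨d, rfl, hd⟩⟩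
  have htgt : ∀ d, M.dual.src d ∈ A → M.tgt d ∈ M.mixed A B := fun d hd => by
    rw [← src_facePerm]
    exact hsrc _ (by rwa [dual_src_facePerm])
  obtain ⟨g, hg⟩ := h.nonempty_left
  obtain ⟨d, rfl, hd⟩ := h.exists_rev_mem hM hM' hg
  have hs1 := hs f₁
  have hs2 := hs f₂
  have c := h.count hM hinj {d} (by
    intro x hx
    obtain rfl := mem_singleton.1 hx
    exact ⟨⟨hsrc _ hg, htgt _ hg⟩, h.left _ hg, h.left _ hd⟩)
  rw [card_singleton] at c
  have c1 := two_mul_card_add_le (f := f₁) (W := M.mixed A B) (fun v hv =>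
    h.exists_dart hinj (mem_mixed.1 hv).1 (mem_mixed.1 hv).2 (Or.inl rfl))
  rw [card_faceDarts] at c1
  have disj : ∀ {f f' : M.Face}, f ≠ f' → Disjoint (M.faceDarts f) (M.faceDarts f') :=
    fun hne => disjoint_left.2 fun x h1 h2 =>
      hne ((mem_faceDarts.1 h1).symm.trans (mem_faceDarts.1 h2))
  have hne1 : M.dual.src d ≠ M.dual.src (M.rev d) := hM'.1 d
  have hd1 := disj hne1
  have hd2 : Disjoint (M.faceDarts (M.dual.src d) ∪ M.faceDarts (M.dual.src (M.rev d)))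
      (M.innerDarts f₁ (M.mixed A B)) := by
    refine Disjoint.mono_right (filter_subset _ _) (disjoint_union_left.2 ⟨disj ?_, disj ?_⟩)
    · exact fun e => h.left _ hg (Or.inl e)
    · exact fun e => h.left _ hd (Or.inl e)
  have tot := card_add_card_le_mul hM (W := M.mixed A B)
    (T := M.faceDarts (M.dual.src d) ∪ M.faceDarts (M.dual.src (M.rev d)) ∪
      M.innerDarts f₁ (M.mixed A B)) (by
    intro x hx
    rcases mem_union.1 hx with hx | hx
    · have hxA : M.dual.src x ∈ A := by
        rcases mem_union.1 hx with hx | hx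
        · rwa [mem_faceDarts.1 hx]
        · rwa [mem_faceDarts.1 hx]
      exact ⟨hsrc x hxA, htgt x hxA⟩
    · exact (mem_filter.1 hx).2)
  rw [card_union_of_disjoint hd2, card_union_of_disjoint hd1] at tot
  have t1 := three_le_card_faceDarts hM hM' (M.dual.src d)
  have t2 := three_le_card_faceDarts hM hM' (M.dual.src (M.rev d))
  -- The basic count with one additional edge excludes four mixed vertices; the six oriented edges
  -- of the two faces of `A` exclude at most three.
  generalize #(M.mixed A B) = m at *
  interval_cases m <;> omega

end IsSeparation

/-! ### Vertex cuts -/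

namespace IsSeparation

variable {f₁ f₂ : M.Face} {A B : Set M.Face}

/-- A set of fewer than `k` vertices that contains the mixed vertices and an end of each edge
leading from the vertices incident to `A` only to those incident to `B` only must contain all
vertices of one of these two kinds. -/
theorem false_of_cut (hM : M.IsSimple) (hM' : M.dual.IsSimple) (h : M.IsSeparation f₁ f₂ A B)
    {k : ℕ} (hk : M.graph.IsKConnected k) {T : Finset M.Vertex} (hT : #T < k)
    (hmix : M.mixed A B ⊆ T)
    (hcross : ∀ d, M.src d ∉ T → M.tgt d ∉ T → ¬M.Touches B (M.src d) →
      M.Touches A (M.tgt d))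
    {x y : M.Vertex} (hx : x ∉ T) (hy : y ∉ T) (hxB : ¬M.Touches B x) (hyA : ¬M.Touches A y) :
    False := by
  have key : ∀ v ∉ T, M.Touches A v → ¬M.Touches B v := fun v hv hA hB =>
    hv (hmix (mem_mixed.2 ⟨hA, hB⟩))
  have hyB := (h.touches_or hM hM' y).resolve_left hyA
  exact of_isKConnected hk hT (fun v => ¬M.Touches B v)
    (fun d h1 h2 hd => key _ h2 (hcross d h1 h2 hd)) hx hy hxB hyB

/-- If an edge joins a vertex incident only to `A` to one incident only to `B`, then deleting one of
its ends and the mixed vertices disconnects the graph, unless no further vertices exist. -/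
theorem le_card_mixed_add_one (hM : M.IsSimple) (hM' : M.dual.IsSimple)
    (h : M.IsSeparation f₁ f₂ A B) {k : ℕ} (hk : M.graph.IsKConnected k) {d : D}
    (hd1 : ¬M.Touches B (M.src d)) (hd2 : ¬M.Touches A (M.tgt d)) :
    k ≤ #(M.mixed A B) + 1 := by
  by_contra! hlt
  have hdA := (h.touches_or hM hM' (M.src d)).resolve_right hd1
  have hdB := (h.touches_or hM hM' (M.tgt d)).resolve_left hd2
  have hne : M.src d ≠ M.tgt d := hM.1 d
  have hs : M.src d ∉ M.mixed A B := fun hc => hd1 (mem_mixed.1 hc).2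
  have ht : M.tgt d ∉ M.mixed A B := fun hc => hd2 (mem_mixed.1 hc).1
  have hcard : ∀ v, #(insert v (M.mixed A B)) < k := fun v =>
    (card_insert_le _ _).trans_lt hlt
  obtain ⟨v, hv⟩ : ∃ v, v ∉ insert (M.src d) (insert (M.tgt d) (M.mixed A B)) := by
    by_contra! hall
    have hle : ENat.card M.Vertex ≤ (#(M.mixed A B) + 2 : ℕ) := by
      have h1 : #(insert (M.src d) (insert (M.tgt d) (M.mixed A B))) ≤ #(M.mixed A B) + 2 :=
        (card_insert_le _ _).trans (Nat.succ_le_succ (card_insert_le _ _))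
      have h2 : (Set.univ : Set M.Vertex) =
          ↑(insert (M.src d) (insert (M.tgt d) (M.mixed A B))) := by
        ext v
        simpa using hall v
      rw [← Set.encard_univ, h2, Set.encard_coe_eq_coe_finsetCard]
      exact_mod_cast h1
    have := hk.1.trans_le hle
    norm_cast at this
    omega
  simp only [mem_insert, not_or] at hv
  obtain ⟨v1, v2, v3⟩ := hv
  by_cases hvA : M.Touches A v
  · have hvB : ¬M.Touches B v := fun hB => v3 (mem_mixed.2 ⟨hvA, hB⟩)
    refine h.false_of_cut hM hM' hk (hcard (M.src d)) (subset_insert _ _) ?_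
      (x := v) (y := M.tgt d) ?_ ?_ hvB hd2
    · intro e he1 _ heB
      by_contra heA
      refine he1 ?_
      rw [h.crossing_unique hM' hd1 hd2 heB heA hdA]
      exact mem_insert_self _ _
    · simp [v1, v3]
    · simp [hne.symm, ht]
  · refine h.false_of_cut hM hM' hk (hcard (M.tgt d)) (subset_insert _ _) ?_
      (x := M.src d) (y := v) ?_ ?_ hd1 hvA
    · intro e _ he2 heB
      by_contra heA
      refine he2 ?_
      rw [h.crossing_unique hM' hd1 hd2 heB heA hdA]
      exact mem_insert_self _ _
    · simp [hne, hs]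
    · simp [v2, v3]

/-- The heart of the matter: under either hypothesis on connectivity and face sizes, the dual has no
separation by two faces. -/
theorem false_of_isKConnected (hM : M.IsSimple) (hM' : M.dual.IsSimple) {k s : ℕ}
    (hks : (k = 3 ∧ s = 4) ∨ (k = 5 ∧ s = 5)) (hk : M.graph.IsKConnected k)
    (hs : ∀ f : M.Face, M.faceSize f ≤ s) (h : M.IsSeparation f₁ f₂ A B) : False := by
  have hs5 : ∀ f : M.Face, M.faceSize f ≤ 5 := fun f => (hs f).trans (by omega)
  have hinj : ∀ d e, M.dual.src d = M.dual.src e → M.src d = M.src e → d = e :=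
    fun d e => src_injOn_face hM hM' hs5
  have hs1 := hs f₁
  have hs2 := hs f₂
  have hle := (h.card_mixed_le hinj).trans hs1
  have hc := h.count hM hinj ∅ (by simp)
  rw [card_empty] at hc
  by_cases hx : ∃ d, ¬M.Touches B (M.src d) ∧ ¬M.Touches A (M.tgt d)
  · obtain ⟨d, hd1, hd2⟩ := hx
    have hkm := h.le_card_mixed_add_one hM hM' hk hd1 hd2
    have hsrc : M.src d ∉ M.mixed A B := fun hc => hd1 (mem_mixed.1 hc).2
    have htgt : M.tgt d ∉ M.mixed A B := fun hc => hd2 (mem_mixed.1 hc).1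
    have hout : ∀ f, f = f₁ ∨ f = f₂ → 1 ≤ #(M.outerDarts f (M.mixed A B)) := by
      intro f hf
      obtain ⟨a, b⟩ := h.sides_of_crossing hd1 hd2
      have hne : M.dual.src d ≠ M.dual.src (M.rev d) := hM'.1 d
      have hor : M.dual.src d = f ∨ M.dual.src (M.rev d) = f := by
        rcases hf with e | e <;> rcases a with a | a <;> rcases b with b | b <;> simp_all
      refine card_pos.2 ?_
      rcases hor with e | e
      · exact ⟨d, mem_filter.2 ⟨mem_faceDarts.2 e, hsrc, htgt⟩⟩
      · exact ⟨M.rev d, mem_filter.2 ⟨mem_faceDarts.2 e, htgt, by rwa [tgt_rev]⟩⟩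
    have o1 := hout f₁ (Or.inl rfl)
    have o2 := hout f₂ (Or.inr rfl)
    generalize #(M.mixed A B) = m at *
    have hm5 : m ≤ 5 := by omega
    -- An edge of both `f₁` and `f₂` away from the mixed vertices makes the basic count fail for
    -- `m ≥ k - 1`.
    interval_cases m <;> omega
  · push Not at hx
    by_cases hkm : #(M.mixed A B) < k
    · have hm4 : #(M.mixed A B) ≤ 4 := by omega
      obtain ⟨x, -, hxB⟩ := h.exists_touches_not_touches hM hM' hinj hs5 hm4
      obtain ⟨y, -, hyA⟩ := h.symm.exists_touches_not_touches hM hM' hinj hs5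
        (mixed_comm A B ▸ hm4)
      exact h.false_of_cut hM hM' hk hkm Subset.rfl (fun d _ _ => hx d)
        (fun hc => hxB (mem_mixed.1 hc).2) (fun hc => hyA (mem_mixed.1 hc).1) hxB hyA
    · -- For `m ≥ k` the basic count leaves only `m = k = 5`, which parity excludes.
      have h5 := h.card_mixed_ne_five hinj (hs5 f₁)
      generalize #(M.mixed A B) = m at *
      have hm5 : m ≤ 5 := by omega
      interval_cases m <;> omega

end IsSeparation

end Counting

/-! ### Connectivity of the dual -/

/-- The dual has at least four vertices: a face and three of its neighbours. -/
theorem three_lt_card_face [Finite D] [Nonempty D] (hM : M.IsSimple) (hM' : M.dual.IsSimple) :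
    3 < Nat.card M.Face := by
  classical
  have := Fintype.ofFinite D
  obtain ⟨d⟩ := ‹Nonempty D›
  have : Finite M.Face := Quotient.finite _
  have := Fintype.ofFinite M.Face
  have h3 := three_le_card_faceDarts hM hM' (M.dual.src d)
  have hinj : Set.InjOn (fun e => M.dual.src (M.rev e)) (M.faceDarts (M.dual.src d)) :=
    fun x hx y hy he =>
      hM'.2 x y ((mem_faceDarts.1 hx).trans (mem_faceDarts.1 hy).symm) he
  have hnot : M.dual.src d ∉
      (M.faceDarts (M.dual.src d)).image (fun e => M.dual.src (M.rev e)) := by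
    rw [mem_image]
    rintro ⟨e, he, he'⟩
    exact hM'.1 e ((mem_faceDarts.1 he).trans he'.symm)
  have hc : _ ≤ Fintype.card M.Face := card_le_univ (insert (M.dual.src d)
    ((M.faceDarts (M.dual.src d)).image (fun e => M.dual.src (M.rev e))))
  rw [card_insert_of_notMem hnot, card_image_of_injOn hinj] at hc
  rw [Nat.card_eq_fintype_card]
  omega

/-- If no two faces separate the dual, then the dual is `3`-connected. Deleting fewer than two faces
is reduced to deleting exactly two by deleting further ones. -/
theorem isKConnected_dual_of_forall_not_isSeparation [Finite D] [Nonempty D] (hM : M.IsSimple)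
    (hM' : M.dual.IsSimple) (h : ∀ f₁ f₂ A B, ¬M.IsSeparation f₁ f₂ A B) :
    M.dual.graph.IsKConnected 3 := by
  classical
  have : Finite M.Face := Quotient.finite _
  have := Fintype.ofFinite M.Face
  have hcard := three_lt_card_face hM hM'
  refine ⟨by rw [ENat.card_eq_coe_natCard]; exact_mod_cast hcard, fun S hS => ?_⟩
  rw [Nat.card_eq_fintype_card] at hcard
  have hne : Nonempty {v : M.Face | v ∉ S} := by
    obtain ⟨v, hv⟩ : ∃ v, v ∉ S := by
      by_contra! hall
      have : S = univ := eq_univ_iff_forall.2 hall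
      have hS' : Fintype.card M.Face < 3 := by rwa [this] at hS
      omega
    exact ⟨⟨v, hv⟩⟩
  refine { preconnected := ?_, nonempty := hne }
  rintro ⟨a, ha⟩ ⟨b, hb⟩
  obtain ⟨S', hSS', hS'sub, hS'⟩ := exists_subsuperset_card_eq (s := S)
    (t := univ \ {a, b}) (n := 2)
    (by
      intro x hx
      simp only [mem_sdiff, mem_univ, mem_insert, mem_singleton, true_and, not_or]
      exact ⟨fun e => ha (e ▸ hx), fun e => hb (e ▸ hx)⟩)
    (by omega)
    (by
      have h1 : #({a, b} : Finset M.Face) ≤ 2 := card_le_two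
      have h2 := le_card_sdiff ({a, b} : Finset M.Face) univ
      rw [card_univ] at h2
      omega)
  obtain ⟨f₁, f₂, hf, rfl⟩ := card_eq_two.1 hS'
  have memS : ∀ f, f ∉ ({f₁, f₂} : Finset M.Face) ↔ ¬(f = f₁ ∨ f = f₂) := fun f => by simp
  have ha' : ¬(a = f₁ ∨ a = f₂) := by
    rw [← memS]
    exact fun hc => by simpa using hS'sub hc
  have hb' : ¬(b = f₁ ∨ b = f₂) := by
    rw [← memS]
    exact fun hc => by simpa using hS'sub hc
  by_contra hreach
  -- The first class consists of the remaining faces reachable from `a`.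
  refine h f₁ f₂
    {f | ¬(f = f₁ ∨ f = f₂) ∧ ∃ hf : f ∉ S,
      (M.dual.graph.induce {v | v ∉ S}).Reachable ⟨a, ha⟩ ⟨f, hf⟩}
    {f | ¬(f = f₁ ∨ f = f₂) ∧ ¬∃ hf : f ∉ S,
      (M.dual.graph.induce {v | v ∉ S}).Reachable ⟨a, ha⟩ ⟨f, hf⟩}
    { ne := hf
      cover := fun f => by
        simp only [Set.mem_ofPred_eq]
        tauto
      disjoint := fun f hf hf' => hf'.2 hf.2
      left := fun f hf => hf.1
      right := fun f hf => hf.1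
      nonadj := ?_
      nonempty_left := ⟨a, ha', ha, SimpleGraph.Reachable.refl _⟩
      nonempty_right := ⟨b, hb', fun ⟨_, hr⟩ => hreach hr⟩ }
  rintro d ⟨-, hd, hr⟩ ⟨hd', hn⟩
  have hdS : M.dual.src (M.rev d) ∉ S := fun hc => (memS _).2 hd' (hSS' hc)
  refine hn ⟨hdS, hr.trans (SimpleGraph.Adj.reachable ?_)⟩
  exact ⟨hM'.1 d, d, rfl, rfl⟩

end CombinatorialMap

theorem mainTheorem2 {D : Type*} [Finite D] (M : CombinatorialMap D)
    (hsimple : M.IsSimple) (hdual : M.dual.IsSimple) :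
    (M.graph.IsKConnected 3 → (∀ f : M.Face, M.faceSize f ≤ 4) →
      M.dual.graph.IsKConnected 3) ∧
    (M.graph.IsKConnected 5 → (∀ f : M.Face, M.faceSize f ≤ 5) →
      M.dual.graph.IsKConnected 3) := by
  have := Fintype.ofFinite D
  have hne : ∀ {k : ℕ}, M.graph.IsKConnected k → Nonempty D := by
    intro k hk
    by_contra hD
    rw [not_nonempty_iff] at hD
    have : IsEmpty M.Vertex := ⟨fun v => hD.elim v.exists_rep.choose⟩
    have h0 := hk.1
    rw [(ENat.card_eq_zero_iff_empty _).2 this] at h0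
    exact not_lt_zero h0
  constructor
  · intro hk hs
    have := hne hk
    exact CombinatorialMap.isKConnected_dual_of_forall_not_isSeparation hsimple hdual
      fun _ _ _ _ h => h.false_of_isKConnected hsimple hdual (Or.inl ⟨rfl, rfl⟩) hk hs
  · intro hk hs
    have := hne hk
    exact CombinatorialMap.isKConnected_dual_of_forall_not_isSeparation hsimple hdual
      fun _ _ _ _ h => h.false_of_isKConnected hsimple hdual (Or.inr ⟨rfl, rfl⟩) hk hs
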